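/- Let $M$ be a paracompact, path connected topological space which is locally contractible in the sense that its open contractible subsets form a base of the topology, let $K$ be the set of (nonempty) open contractible subsets of $M$ ordered by inclusion, and let $G$ be a group. **Definitions.** A 1-simplex $b=(|b|;\partial_0b,\partial_1b)$ of $K$ consists of $\partial_0 b,\partial_1 b,|b|\in K$ with $\partial_0b,\partial_1b\le|b|$; a 2-simplex $c$ with vertices $v_0,v_1,v_2\in K$ consists of 1-simplices $\partial_0c$ from $v_1$ to $v_2$, $\partial_1c$ from $v_0$ to $v_2$, $\partial_2c$ from $v_0$ to $v_1$ (a 1-simplex $b$ goes from $\partial_1b$ to $\partial_0b$) and of an element $|c|\in K$ with $|\partial_ic|\le|c|$. A path is a nonempty composable sequence $p=b_n*\cdots*b_1$ of 1-simplices, $\partial_0b_i=\partial_1b_{i+1}$; homotopy of paths is the equivalence relation compatible with concatenation generated by $\partial_1c\sim\partial_0c*\partial_2c$; and $\pi_1(K,a)$ is the group of homotopy classes of loops at $a\in K$. A 1-cocycle is a $G$-valued function $z$ on 1-simplices with $z(\partial_0c)z(\partial_2c)=z(\partial_1c)$ for every 2-simplex $c$; put $z(b_n*\cdots*b_1)=z(b_n)\cdots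 z(b_1)$. Cocycles $z,z'$ are equivalent if there is $\mathrm f:K\to G$ with $\mathrm f_{\partial_0p}\,z(p)=z'(p)\,\mathrm f_{\partial_1p}$ for all paths $p$, and $\mathrm H^1(K,G)$ is the set of equivalence classes. For a group $H$, $\dot{\mathrm H}\mathrm{om}(H,G)$ is the set of homomorphisms $H\to G$ modulo inner automorphisms of $G$. A locally constant cocycle is a pair $(A,f)$ where $A\subseteq K$ is a locally finite cover of $M$ and $f_{a'a}:a\cap a'\to G$ ($a,a'\in A$) are locally constant maps with $f_{a''a'}(x)f_{a'a}(x)=f_{a''a}(x)$ on $a\cap a'\cap a''$. It is equivalent to $(\tilde A,\tilde f)$ if there are locally constant maps $v_{a\tilde a}:a\cap\tilde a\to G$ ($a\in A$, $\tilde a\in\tilde A$) with $v_{a\tilde a}\tilde f_{\tilde a\tilde a'}=f_{aa'}v_{a'\tilde a'}$ on $a\cap a'\cap\tilde a\cap\tilde a'$; $\mathrm H^1_{lc}(M,G)$ is the set of equivalence classes. **Theorem.** Let $a_0\in K$ and $x_0\in a_0$. 1. The assignment $[z]\mapsto\big[\,[p]\mapsto z(p)\,\big]$ is a well-defined bijection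 $\mathrm H^1(K,G)\simeq\dot{\mathrm H}\mathrm{om}(\pi_1(K,a_0),G)$. 2. There is a group isomorphism $\varphi:\pi_1(K,a_0)\to\pi_1(M,x_0)$ with $\varphi([b_n*\cdots*b_1])=[\gamma]$ whenever the loop $\gamma$ at $x_0$ is an iterated concatenation of paths $\gamma_1,\dots,\gamma_n$ (first $\gamma_1$), $\gamma_i$ running inside $|b_i|$ from a point of $\partial_1b_i$ to a point of $\partial_0b_i$; and $[\chi]\mapsto[\chi\circ\varphi^{-1}]$ is a bijection $\dot{\mathrm H}\mathrm{om}(\pi_1(K,a_0),G)\simeq\dot{\mathrm H}\mathrm{om}(\pi_1(M,x_0),G)$. 3. If $K$ contains a locally finite cover of $M$, then there is a bijection $\dot{\mathrm H}\mathrm{om}(\pi_1(M,x_0),G)\simeq\mathrm H^1_{lc}(M,G)$ whose composition with the two bijections above sends $[z]$, for every locally finite cover $A\subseteq K$ of $M$, to the class of $(A,f)$ with $f_{aa'}(x)=z(a;a,o)\,z(a';a',o)^{-1}$ for $x\in o\in K$, $o\subseteq a\cap a'$. If $M$ is locally compact and Hausdorff (for instance a manifold), then $K$ contains a locally finite cover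 of $M$. -/

import Mathlib

open TopologicalSpace

universe u v w

namespace NetCoh

/-! ### The simplicial set of a poset: paths and homotopy -/

section Poset

variable {K : Type u} [PartialOrder K]

/-- A 1-simplex `b` of the symmetric simplicial set of a poset with `∂₁ b = a₁` (initial vertex)
and `∂₀ b = a₀` (final vertex): an element `|b|` of the poset, the support, which dominates both
vertices.  In the notation of simplices by support and faces this is `(|b|; a₀, a₁)`. -/
structure OneSimplex (a₁ a₀ : K) where
  supp : K
  le₁ : a₁ ≤ supp
  le₀ : a₀ ≤ supp

namespace OneSimplex

/-- The degenerate 1-simplex `σ₀ a = (a; a, a)`. -/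
def degen (a : K) : OneSimplex a a := ⟨a, le_rfl, le_rfl⟩

/-- The reverse of a 1-simplex. -/
def rev {a₁ a₀ : K} (b : OneSimplex a₁ a₀) : OneSimplex a₀ a₁ := ⟨b.supp, b.le₀, b.le₁⟩

/-- For `o ≤ a`, the 1-simplex `(a; a, o)` of the nerve, going from `o` to `a`. -/
def ofLE {o a : K} (h : o ≤ a) : OneSimplex o a := ⟨a, h, le_rfl⟩

end OneSimplex

/-- A 2-simplex `c` with vertices `v₀, v₁, v₂`: three 1-simplices `∂₀ c : v₁ → v₂`,
`∂₁ c : v₀ → v₂`, `∂₂ c : v₀ → v₁` and a support `|c|` dominating their supports.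
Equivalently, an order preserving map to `K` from the nonempty subsets of a 3-element set. -/
structure TwoSimplex (v₀ v₁ v₂ : K) where
  d₀ : OneSimplex v₁ v₂
  d₁ : OneSimplex v₀ v₂
  d₂ : OneSimplex v₀ v₁
  supp : K
  le₀ : d₀.supp ≤ supp
  le₁ : d₁.supp ≤ supp
  le₂ : d₂.supp ≤ supp

/-- A path in the simplicial set: a nonempty sequence of composable 1-simplices.
`p.cons b` is the path written `b * p`: first `p`, then `b`. -/
inductive SPath : K → K → Type u
  | of {a a' : K} (b : OneSimplex a a') : SPath a a'
  | cons {a a' a'' : K} (p : SPath a a') (b : OneSimplex a' a'') : SPath a a''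

namespace SPath

/-- Concatenation: first `p`, then `q` (written `q * p`). -/
def append {a a' : K} (p : SPath a a') : {a'' : K} → SPath a' a'' → SPath a a''
  | _, of b => cons p b
  | _, cons q b => cons (append p q) b

/-- The reverse path. -/
def rev {a a' : K} : SPath a a' → SPath a' a
  | of b => of b.rev
  | cons p b => append (of b.rev) (rev p)

theorem append_assoc {a a' a'' a''' : K} (p : SPath a a') (q : SPath a' a'')
    (r : SPath a'' a''') : (p.append q).append r = p.append (q.append r) := by
  induction r with
  | of b => rfl
  | cons r b ih => simp only [append, ih]

end SPath

/-- Homotopy of paths: the equivalence relation, compatible with concatenation, generated by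
`∂₁ c ∼ ∂₀ c * ∂₂ c` for the 2-simplices `c`. -/
inductive SPath.Homotopic : {a a' : K} → SPath a a' → SPath a a' → Prop
  | triangle {v₀ v₁ v₂ : K} (c : TwoSimplex v₀ v₁ v₂) :
      SPath.Homotopic (.of c.d₁) (.cons (.of c.d₂) c.d₀)
  | append_left {a a' a'' : K} (p : SPath a a') {q q' : SPath a' a''}
      (h : SPath.Homotopic q q') : SPath.Homotopic (p.append q) (p.append q')
  | append_right {a a' a'' : K} {p p' : SPath a a'} (q : SPath a' a'')
      (h : SPath.Homotopic p p') : SPath.Homotopic (p.append q) (p'.append q)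
  | refl {a a' : K} (p : SPath a a') : SPath.Homotopic p p
  | symm {a a' : K} {p q : SPath a a'} (h : SPath.Homotopic p q) : SPath.Homotopic q p
  | trans {a a' : K} {p q r : SPath a a'} (h : SPath.Homotopic p q)
      (h' : SPath.Homotopic q r) : SPath.Homotopic p r

namespace SPath

theorem Homotopic.append {a a' a'' : K} {p p' : SPath a a'} {q q' : SPath a' a''}
    (h : Homotopic p p') (h' : Homotopic q q') : Homotopic (p.append q) (p'.append q') :=
  (Homotopic.append_right q h).trans (Homotopic.append_left p' h')

theorem append_degen {a a' : K} (p : SPath a a') :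
    Homotopic (p.append (of (.degen a'))) p := by
  have key : ∀ {a : K} (b : OneSimplex a a'),
      Homotopic ((of b).append (of (.degen a'))) (of b) := fun b =>
    (Homotopic.triangle ⟨.degen a', b, b, b.supp, b.le₀, le_rfl, le_rfl⟩).symm
  cases p with
  | of b => exact key b
  | cons p b =>
    have := Homotopic.append_left p (key b)
    exact this

theorem degen_append {a a' : K} (p : SPath a a') :
    Homotopic ((of (.degen a)).append p) p := by
  induction p with
  | of b => exact (Homotopic.triangle ⟨b, b, .degen _, b.supp, le_rfl, le_rfl, b.le₁⟩).symm
  | cons p b ih => exact Homotopic.append_right (of b) ih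

theorem append_rev {a a' : K} (p : SPath a a') :
    Homotopic (p.append p.rev) (of (.degen a)) := by
  have key : ∀ {a a' : K} (b : OneSimplex a a'),
      Homotopic ((of b).append (of b.rev)) (of (.degen a)) := fun b =>
    (Homotopic.triangle ⟨b.rev, .degen _, b, b.supp, le_rfl, b.le₁, le_rfl⟩).symm
  induction p with
  | of b => exact key b
  | cons p b ih =>
    have h1 : (cons p b).append (rev (cons p b))
        = (p.append ((of b).append (of b.rev))).append p.rev := by
      change (p.append (of b)).append ((of b.rev).append p.rev) = _
      simp only [append_assoc]
    rw [h1]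
    exact (Homotopic.append_right _
      ((Homotopic.append_left p (key b)).trans (append_degen p))).trans ih

theorem rev_append {a a' : K} (p : SPath a a') :
    Homotopic (p.rev.append p) (of (.degen a')) := by
  have key : ∀ {a a' : K} (b : OneSimplex a a'),
      Homotopic ((of b.rev).append (of b)) (of (.degen a')) := fun b =>
    (Homotopic.triangle ⟨b, .degen _, b.rev, b.supp, le_rfl, b.le₀, le_rfl⟩).symm
  induction p with
  | of b => exact key b
  | cons p b ih =>
    have h1 : (rev (cons p b)).append (cons p b)
        = ((of b.rev).append (p.rev.append p)).append (of b) := by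
      change ((of b.rev).append p.rev).append (p.append (of b)) = _
      simp only [append_assoc]
    rw [h1]
    exact (Homotopic.append_right _
      ((Homotopic.append_left _ ih).trans (append_degen _))).trans (key b)

/-- Homotopy as a setoid on the paths with given ends. -/
instance setoid (a a' : K) : Setoid (SPath a a') where
  r := Homotopic
  iseqv := ⟨Homotopic.refl, Homotopic.symm, Homotopic.trans⟩

theorem homotopic_rev {a a' : K} {p q : SPath a a'} (h : Homotopic p q) :
    Homotopic p.rev q.rev := by
  have h1 : Homotopic (p.rev.append (q.append q.rev)) p.rev :=
    (Homotopic.append_left _ (append_rev q)).trans (append_degen _)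
  have h2 : Homotopic (p.rev.append (q.append q.rev)) q.rev := by
    rw [← append_assoc]
    exact (Homotopic.append_right _
      ((Homotopic.append_left _ h.symm).trans (rev_append p))).trans (degen_append _)
  exact h1.symm.trans h2

end SPath

/-- The fundamental group of a poset at the base point `a`: homotopy classes of loops at `a`,
that is, the vertex group at `a` of the homotopy groupoid of the poset. -/
def PosetPi1 (a : K) : Type u := Quotient (SPath.setoid a a)

/-- The homotopy class of a loop. -/
def PosetPi1.mk {a : K} (p : SPath a a) : PosetPi1 a := Quotient.mk _ p

/-- The product `[p] * [q]` is the class of `p * q`: first `q`, then `p`. -/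
instance (a : K) : Group (PosetPi1 a) where
  mul := Quotient.map₂ (fun p q => q.append p) (fun _ _ h _ _ h' => h'.append h)
  one := PosetPi1.mk (.of (.degen a))
  inv := Quotient.map SPath.rev (fun _ _ h => SPath.homotopic_rev h)
  mul_assoc := by
    rintro ⟨p⟩ ⟨q⟩ ⟨r⟩
    exact congrArg (Quotient.mk _) (SPath.append_assoc r q p).symm
  one_mul := by
    rintro ⟨p⟩
    exact Quotient.sound (SPath.append_degen p)
  mul_one := by
    rintro ⟨p⟩
    exact Quotient.sound (SPath.degen_append p)
  inv_mul_cancel := by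
    rintro ⟨p⟩
    exact Quotient.sound (SPath.append_rev p)

end Poset

/-! ### Homomorphisms up to conjugation -/

/-- Two homomorphisms `H → G` are conjugate if they differ by an inner automorphism of `G`. -/
instance homConj (H : Type w) (G : Type v) [Group H] [Group G] : Setoid (H →* G) where
  r χ χ' := ∃ g : G, ∀ h : H, χ' h = g * χ h * g⁻¹
  iseqv := by
    refine ⟨fun χ => ⟨1, fun h => by simp⟩, ?_, ?_⟩
    · rintro χ χ' ⟨g, hg⟩
      exact ⟨g⁻¹, fun h => by rw [hg]; group⟩
    · rintro χ χ' χ'' ⟨g, hg⟩ ⟨g', hg'⟩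
      exact ⟨g' * g, fun h => by rw [hg', hg]; group⟩

/-- The set of homomorphisms `H → G` modulo inner automorphisms of `G`. -/
def HomConj (H : Type w) (G : Type v) [Group H] [Group G] : Type (max w v) :=
  Quotient (homConj H G)

/-- The class of a homomorphism modulo inner automorphisms. -/
def HomConj.mk {H : Type w} {G : Type v} [Group H] [Group G] (χ : H →* G) : HomConj H G :=
  Quotient.mk _ χ

/-! ### The first cohomology of a poset -/

/-- A 1-cocycle of the poset `K` with values in `G`: a function on the 1-simplices with
`z (∂₀ c) z (∂₂ c) = z (∂₁ c)` for all 2-simplices `c`. -/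
structure Cocycle (K : Type u) [PartialOrder K] (G : Type v) [Group G] where
  val : {a₁ a₀ : K} → OneSimplex a₁ a₀ → G
  cocycle : ∀ {v₀ v₁ v₂ : K} (c : TwoSimplex v₀ v₁ v₂), val c.d₀ * val c.d₂ = val c.d₁

namespace Cocycle

variable {K : Type u} [PartialOrder K] {G : Type v} [Group G]

/-- The extension to paths, `z (b_n * ⋯ * b_1) = z (b_n) ⋯ z (b_1)`. -/
def onPath (z : Cocycle K G) {a a' : K} : SPath a a' → G
  | .of b => z.val b
  | .cons p b => z.val b * z.onPath p

theorem onPath_append (z : Cocycle K G) {a a' a'' : K} (p : SPath a a') (q : SPath a' a'') :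
    z.onPath (p.append q) = z.onPath q * z.onPath p := by
  induction q with
  | of b => rfl
  | cons q b ih => simp only [SPath.append, onPath, ih, mul_assoc]

theorem onPath_homotopic (z : Cocycle K G) {a a' : K} {p q : SPath a a'}
    (h : SPath.Homotopic p q) : z.onPath p = z.onPath q := by
  induction h with
  | triangle c => exact (z.cocycle c).symm
  | append_left p h ih => rw [onPath_append, onPath_append, ih]
  | append_right q h ih => rw [onPath_append, onPath_append, ih]
  | refl p => rfl
  | symm h ih => exact ih.symm
  | trans h h' ih ih' => exact ih.trans ih'

/-- `z` and `z'` are equivalent if there is `f : K → G` with `f (∂₀ p) z (p) = z' (p) f (∂₁ p)`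
for all paths `p`. -/
instance setoid (K : Type u) [PartialOrder K] (G : Type v) [Group G] :
    Setoid (Cocycle K G) where
  r z z' := ∃ f : K → G, ∀ {a a' : K} (p : SPath a a'),
    f a' * z.onPath p = z'.onPath p * f a
  iseqv := by
    refine ⟨fun z => ⟨1, fun p => by simp⟩, ?_, ?_⟩
    · rintro z z' ⟨f, hf⟩
      refine ⟨fun a => (f a)⁻¹, fun {a a'} p => ?_⟩
      rw [inv_mul_eq_iff_eq_mul, ← mul_assoc, hf p, mul_inv_cancel_right]
    · rintro z z' z'' ⟨f, hf⟩ ⟨g, hg⟩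
      exact ⟨fun a => g a * f a, fun {a a'} p => by
        rw [mul_assoc, hf p, ← mul_assoc, hg p, mul_assoc]⟩

/-- The homomorphism `[p] ↦ z (p)` defined by a 1-cocycle on the fundamental group. -/
def hom (z : Cocycle K G) (a : K) : PosetPi1 a →* G where
  toFun := Quotient.lift (fun p => z.onPath p) (fun _ _ h => z.onPath_homotopic h)
  map_one' := by
    have h := z.onPath_homotopic (SPath.append_degen (.of (.degen a)))
    rw [onPath_append] at h
    exact mul_eq_left.mp h
  map_mul' := by
    rintro ⟨p⟩ ⟨q⟩
    exact z.onPath_append q p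

end Cocycle

/-- The first cohomology set `H¹(K, G)` of a poset. -/
def H1 (K : Type u) [PartialOrder K] (G : Type v) [Group G] : Type (max u v) :=
  Quotient (Cocycle.setoid K G)

/-- The cohomology class of a 1-cocycle. -/
def H1.mk {K : Type u} [PartialOrder K] {G : Type v} [Group G] (z : Cocycle K G) : H1 K G :=
  Quotient.mk _ z

/-! ### Open contractible subsets and locally constant cohomology -/

/-- The poset of the open contractible (in particular nonempty) subsets of `M`, ordered by
inclusion. -/
abbrev OpenContr (M : Type u) [TopologicalSpace M] : Type u :=
  {U : Opens M // ContractibleSpace U}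

/-- `M` is locally contractible: its open contractible subsets form a base of the topology. -/
def LocContractible (M : Type u) [TopologicalSpace M] : Prop :=
  IsTopologicalBasis {U : Set M | IsOpen U ∧ ContractibleSpace U}

/-- `A` is a locally finite cover of `M` by open contractible subsets. -/
structure IsLFCover {M : Type u} [TopologicalSpace M] (A : Set (OpenContr M)) : Prop where
  cover : ∀ x : M, ∃ a ∈ A, x ∈ a.1
  locallyFinite : LocallyFinite (fun a : A => (a.1.1 : Set M))

/-- A locally constant cocycle `(A, f)`: a locally finite cover `A` of `M` by open contractible
sets and locally constant maps `f a' a : a ∩ a' → G`, for `a, a' ∈ A`, satisfying the cocycle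
relations. -/
structure LCCocycle (M : Type u) [TopologicalSpace M] (G : Type v) [Group G] where
  A : Set (OpenContr M)
  isLFCover : IsLFCover A
  f : (a' a : A) → {x : M // x ∈ a'.1.1 ∧ x ∈ a.1.1} → G
  locConst : ∀ a' a : A, IsLocallyConstant (f a' a)
  cocycle : ∀ (a a' a'' : A) (x : M) (h : x ∈ a.1.1) (h' : x ∈ a'.1.1) (h'' : x ∈ a''.1.1),
    f a'' a' ⟨x, h'', h'⟩ * f a' a ⟨x, h', h⟩ = f a'' a ⟨x, h'', h⟩

namespace LCCocycle

variable {M : Type u} [TopologicalSpace M] {G : Type v} [Group G]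

/-- Equivalence of locally constant cocycles `c = (A, f)` and `c' = (A', f')`: there are locally
constant maps `v a b : a ∩ b → G`, for `a ∈ A` and `b ∈ A'`, such that
`v a b · f' b b' = f a a' · v a' b'` on `a ∩ a' ∩ b ∩ b'`. -/
def Equiv (c c' : LCCocycle M G) : Prop :=
  ∃ v : (a : c.A) → (b : c'.A) → {x : M // x ∈ a.1.1 ∧ x ∈ b.1.1} → G,
    (∀ a b, IsLocallyConstant (v a b)) ∧
    ∀ (a a' : c.A) (b b' : c'.A) (x : M) (ha : x ∈ a.1.1) (ha' : x ∈ a'.1.1)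
      (hb : x ∈ b.1.1) (hb' : x ∈ b'.1.1),
      v a b ⟨x, ha, hb⟩ * c'.f b b' ⟨x, hb, hb'⟩ = c.f a a' ⟨x, ha, ha'⟩ * v a' b' ⟨x, ha', hb'⟩

theorem f_self (c : LCCocycle M G) (a : c.A) (x : M) (h : x ∈ a.1.1) :
    c.f a a ⟨x, h, h⟩ = 1 :=
  mul_eq_left.mp (c.cocycle a a a x h h h)

theorem equiv_refl (c : LCCocycle M G) : Equiv c c :=
  ⟨c.f, c.locConst, fun a a' b b' x ha ha' hb hb' => by
    rw [c.cocycle b' b a x hb' hb ha, c.cocycle b' a' a x hb' ha' ha]⟩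

theorem equiv_symm {c c' : LCCocycle M G} (h : Equiv c c') : Equiv c' c := by
  obtain ⟨v, hv, h⟩ := h
  refine ⟨fun b a x => (v a b ⟨x.1, x.2.2, x.2.1⟩)⁻¹, fun b a => ?_, ?_⟩
  · have : Continuous (fun x : {x : M // x ∈ b.1.1 ∧ x ∈ a.1.1} =>
        (⟨x.1, x.2.2, x.2.1⟩ : {x : M // x ∈ a.1.1 ∧ x ∈ b.1.1})) := by fun_prop
    exact ((hv a b).comp_continuous this).inv
  · intro b b' a a' x hb hb' ha ha'
    rw [inv_mul_eq_iff_eq_mul, ← mul_assoc, h a a' b b' x ha ha' hb hb', mul_inv_cancel_right]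

theorem equiv_trans {c c' c'' : LCCocycle M G} (h : Equiv c c') (h' : Equiv c' c'') :
    Equiv c c'' := by
  obtain ⟨v, hv, h⟩ := h
  obtain ⟨w, hw, h'⟩ := h'
  choose s hsA hs using c'.isLFCover.cover
  have indep : ∀ (a : c.A) (d : c''.A) (b b' : c'.A) (x : M) (ha : x ∈ a.1.1) (hd : x ∈ d.1.1)
      (hb : x ∈ b.1.1) (hb' : x ∈ b'.1.1),
      v a b ⟨x, ha, hb⟩ * w b d ⟨x, hb, hd⟩ = v a b' ⟨x, ha, hb'⟩ * w b' d ⟨x, hb', hd⟩ := by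
    intro a d b b' x ha hd hb hb'
    have e1 := h a a b b' x ha ha hb hb'
    have e2 := h' b b' d d x hb hb' hd hd
    rw [f_self c a x ha, one_mul] at e1
    rw [f_self c'' d x hd, mul_one] at e2
    rw [e2, ← mul_assoc, e1]
  refine ⟨fun a d x => v a ⟨s x.1, hsA x.1⟩ ⟨x.1, x.2.1, hs x.1⟩
    * w ⟨s x.1, hsA x.1⟩ d ⟨x.1, hs x.1, x.2.2⟩, fun a d => ?_, ?_⟩
  · rw [IsLocallyConstant.iff_eventually_eq]
    rintro ⟨x, ha, hd⟩
    have e1 := (IsLocallyConstant.iff_eventually_eq _).1 (hv a ⟨s x, hsA x⟩) ⟨x, ha, hs x⟩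
    have e2 := (IsLocallyConstant.iff_eventually_eq _).1 (hw ⟨s x, hsA x⟩ d) ⟨x, hs x, hd⟩
    rw [nhds_subtype_eq_comap, Filter.eventually_comap] at e1 e2 ⊢
    filter_upwards [e1, e2, (s x).1.isOpen.mem_nhds (hs x)] with y h1 h2 hy
    rintro ⟨y', ha', hd'⟩ rfl
    dsimp only
    rw [indep a d _ ⟨s x, hsA x⟩ y' ha' hd' (hs y') hy, h1 ⟨y', ha', hy⟩ rfl,
      h2 ⟨y', hy, hd'⟩ rfl]
  · intro a a' d d' x ha ha' hd hd'
    dsimp only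
    rw [mul_assoc, h' _ ⟨s x, hsA x⟩ d d' x (hs x) (hs x) hd hd', ← mul_assoc,
      h a a' _ ⟨s x, hsA x⟩ x ha ha' (hs x) (hs x), mul_assoc]

instance setoid (M : Type u) [TopologicalSpace M] (G : Type v) [Group G] :
    Setoid (LCCocycle M G) where
  r := Equiv
  iseqv := ⟨equiv_refl, equiv_symm, equiv_trans⟩

end LCCocycle

/-- The first locally constant cohomology set of `M` with values in `G`. -/
def H1lc (M : Type u) [TopologicalSpace M] (G : Type v) [Group G] : Type (max u v) :=
  Quotient (LCCocycle.setoid M G)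

/-- The class of a locally constant cocycle. -/
def H1lc.mk {M : Type u} [TopologicalSpace M] {G : Type v} [Group G] (c : LCCocycle M G) :
    H1lc M G :=
  Quotient.mk _ c

/-! ### Comparison of paths in the poset with paths in the space, and of cocycles -/

/-- The path `γ` in `M` follows the path `b_n * ⋯ * b_1` of the poset: `γ` is an iterated
concatenation of `γ_1, …, γ_n`, where `γ_i` runs inside the support `|b_i|` from a point of
`∂₁ b_i` to a point of `∂₀ b_i`. -/
inductive Follows {M : Type u} [TopologicalSpace M] :
    {a a' : OpenContr M} → SPath a a' → {x x' : M} → Path x x' → Prop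
  | of {a a' : OpenContr M} (b : OneSimplex a a') {x x' : M} (γ : Path x x')
      (hx : x ∈ a.1) (hx' : x' ∈ a'.1) (hγ : ∀ t, γ t ∈ b.supp.1) : Follows (.of b) γ
  | cons {a a' a'' : OpenContr M} (p : SPath a a') (b : OneSimplex a' a'') {x x' x'' : M}
      (γ : Path x x') (δ : Path x' x'') (hp : Follows p γ)
      (hx'' : x'' ∈ a''.1) (hδ : ∀ t, δ t ∈ b.supp.1) : Follows (.cons p b) (γ.trans δ)

/-- The locally constant cocycle `c = (A, f)` is the one induced by the 1-cocycle `z`: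
`f a a' (x) = z (a; a, o) z (a'; a', o)⁻¹` whenever `x ∈ o ⊆ a ∩ a'`. -/
def IsInducedBy {M : Type u} [TopologicalSpace M] {G : Type v} [Group G] (c : LCCocycle M G)
    (z : Cocycle (OpenContr M) G) : Prop :=
  ∀ (a a' : c.A) (o : OpenContr M) (h : o ≤ a.1) (h' : o ≤ a'.1) (x : M) (hx : x ∈ o.1),
    c.f a a' ⟨x, h hx, h' hx⟩ = z.val (OneSimplex.ofLE h) * (z.val (OneSimplex.ofLE h'))⁻¹

end NetCoh

/-!
The bridge between the poset `K` of open contractible sets and the space `M` is one fact about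
covering spaces: over a simply connected, locally path connected space every locally constant
cocycle is trivial (`exists_trivialization`), since the covering it defines has a section.

*Cohomology and the poset group.* Paths joining the base point to all vertices turn a homomorphism
`χ` on `π₁(K, a₀)` into the cocycle `b ↦ χ [loop through b]` (`Cocycle.ofHom`), and they extend a
conjugation between two holonomies to an equivalence of cocycles (`Cocycle.equiv_iff_hom`).

*The poset group and the group of the space.* All paths with given ends inside a contractible set
are homotopic, so a path of the poset has a well-defined class in the fundamental groupoid of `M`
(`SPath.realBetween`), invariant under the triangle relations.  The resulting homomorphism is onto
because a path in `M` can be cut into pieces lying in members of `K` (`exists_realBetween_eq`).  It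
is injective because the holonomy of any cocycle `z` along a loop `p` depends only on the class of a
path in `M` following `p`: pulled back along a null-homotopy, the locally constant cocycle of `z` is
trivial on the square, and a trivialization computes `z (p)` as the discrepancy between the two ends
of the loop (`Follows.apply_mul_onPath`).  For the tautological cocycle with values in `π₁(K, a₀)`
the holonomy is the class of `p` itself up to conjugation.

*Cohomology and locally constant cohomology.* The transition functions of `z` make sense for every
pair of members of `K`, not only for those of a given cover, so an equivalence over the covers
extends to a locally constant family on each `o ∈ K`, which is constant because `o` is connected
(`LCCocycle.equiv_of_ofCocycle_equiv`).  Conversely a locally constant cocycle is trivial over each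
contractible `o`, and comparing the trivializations over `o ⊆ o'` gives a cocycle of the poset
(`LCCocycle.exists_equiv_ofCocycle`).

The locally finite cover in the locally compact Hausdorff case comes from σ-compactness, which
connectedness and paracompactness provide (`sigmaCompactSpace_of_connected`).
-/

/-! ### Locally finite covers and triviality of coverings -/

section Topology

open Filter Topology Set

/-- Starting from a point and repeatedly adding all members of a locally finite, relatively compact
cover that meet the compact set already reached, one exhausts a connected space. -/
theorem sigmaCompactSpace_of_connected {X : Type u} [TopologicalSpace X] [ParacompactSpace X]
    [WeaklyLocallyCompactSpace X] [ConnectedSpace X] : SigmaCompactSpace X := by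
  choose N hNc hN using fun x : X => exists_compact_mem_nhds x
  obtain ⟨V, hVo, hVu, hVf, hVN⟩ := precise_refinement (fun x => interior (N x))
    (fun _ => isOpen_interior)
    (eq_univ_of_forall fun x => mem_iUnion.2 ⟨x, mem_interior_iff_mem_nhds.2 (hN x)⟩)
  have hcov : ∀ y, ∃ j, y ∈ V j := fun y => mem_iUnion.1 (hVu ▸ mem_univ y)
  have step : ∀ C : Compacts X, ∃ C' : Compacts X,
      ∀ j, (V j ∩ C).Nonempty → V j ⊆ (C' : Set X) := fun C => by
    have hfin := hVf.finite_nonempty_inter_compact C.isCompact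
    refine ⟨⟨⋃ j ∈ {j | (V j ∩ C).Nonempty}, N j, hfin.isCompact_biUnion fun j _ => hNc j⟩,
      fun j hj => ?_⟩
    exact ((hVN j).trans interior_subset).trans (subset_biUnion_of_mem (u := fun j => N j) hj)
  choose next hnext using step
  obtain ⟨x₀⟩ := (inferInstance : Nonempty X)
  let C : ℕ → Compacts X := fun n => next^[n] ⟨{x₀}, isCompact_singleton⟩
  have hC : ∀ n j, (V j ∩ C n).Nonempty → V j ⊆ (C (n + 1) : Set X) := fun n j hj => by
    have := hnext (C n) j hj
    rwa [← Function.iterate_succ_apply' next n] at this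
  have hclopen : IsClopen (⋃ n, (C n : Set X)) := by
    constructor
    · rw [← isOpen_compl_iff, isOpen_iff_mem_nhds]
      intro y hy
      obtain ⟨j, hj⟩ := hcov y
      filter_upwards [(hVo j).mem_nhds hj] with y' hy' hmem
      obtain ⟨n, hn⟩ := mem_iUnion.1 hmem
      exact hy (mem_iUnion.2 ⟨n + 1, hC n j ⟨y', hy', hn⟩ hj⟩)
    · rw [isOpen_iff_mem_nhds]
      intro y hy
      obtain ⟨n, hn⟩ := mem_iUnion.1 hy
      obtain ⟨j, hj⟩ := hcov y
      filter_upwards [(hVo j).mem_nhds hj] with y' hy'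
      exact mem_iUnion.2 ⟨n + 1, hC n j ⟨y, hj, hn⟩ hy'⟩
  exact ⟨⟨fun n => C n, fun n => (C n).isCompact,
    hclopen.eq_univ ⟨x₀, mem_iUnion.2 ⟨0, mem_singleton x₀⟩⟩⟩⟩

/-- A locally constant cocycle on a simply connected, locally path connected space is trivial. -/
theorem exists_trivialization {X : Type u} {ι : Type w} {G : Type v} [TopologicalSpace X]
    [SimplyConnectedSpace X] [LocallyPathConnectedSpace X] [Group G] (U : ι → Set X)
    (hU : ∀ i, IsOpen (U i)) (hcov : ∀ x, ∃ i, x ∈ U i) (f : ι → ι → X → G)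
    (hf : ∀ i j x, x ∈ U i → x ∈ U j → ∀ᶠ y in 𝓝 x, f i j y = f i j x)
    (hc : ∀ i j k x, x ∈ U i → x ∈ U j → x ∈ U k → f i j x * f j k x = f i k x) :
    ∃ h : ι → X → G, (∀ i x, x ∈ U i → ∀ᶠ y in 𝓝 x, h i y = h i x) ∧
      ∀ i j x, x ∈ U i → x ∈ U j → h i x * f i j x = h j x := by
  -- The bundle with fibre the discrete space `G` and coordinate changes `g ↦ g * f i j` is a
  -- covering; lifting the identity gives a section, read off in the charts.
  let : TopologicalSpace G := ⊥
  have : DiscreteTopology G := ⟨rfl⟩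
  choose idx hidx using hcov
  let Z : FiberBundleCore ι X G :=
    { baseSet := U
      isOpen_baseSet := hU
      indexAt := idx
      mem_baseSet_at := hidx
      coordChange := fun i j x g => g * f i j x
      coordChange_self := fun i x hx g => by
        rw [mul_eq_left.1 (hc i i i x hx hx hx), mul_one]
      continuousOn_coordChange := fun i j => by
        rintro ⟨x, g⟩ ⟨⟨hi, hj⟩, -⟩
        refine ContinuousAt.continuousWithinAt ?_
        refine continuousAt_snd.mul (ContinuousAt.comp (f := Prod.fst) ?_ continuousAt_fst)
        exact (continuousAt_const (y := f i j x)).congr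
          ((hf i j x hi hj).mono fun y hy => hy.symm)
      coordChange_comp := fun i j k x hx g => by
        rw [mul_assoc, hc i j k x hx.1.1 hx.1.2 hx.2] }
  have cov : IsCoveringMap (Bundle.TotalSpace.proj : Z.TotalSpace → X) :=
    FiberBundle.isCoveringMap (F := G) (E := Z.Fiber)
  obtain ⟨x₀⟩ := (inferInstance : Nonempty X)
  obtain ⟨s, ⟨-, hs⟩, -⟩ := cov.existsUnique_continuousMap_lifts (ContinuousMap.id X) x₀
    (⟨x₀, (1 : G)⟩ : Z.TotalSpace) rfl
  have hs' : ∀ x, (s x).1 = x := fun x => congrFun hs x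
  refine ⟨fun i x => (Z.localTriv i (s x)).2, fun i x hx => ?_, fun i j x hi hj => ?_⟩
  · have h1 : ContinuousAt (fun y => (Z.localTriv i (s y)).2) x := by
      refine continuousAt_snd.comp (ContinuousAt.comp (f := s) ?_ s.continuous.continuousAt)
      refine (Z.localTriv i).toOpenPartialHomeomorph.continuousAt ?_
      change s x ∈ (Z.localTriv i).source
      rw [FiberBundleCore.mem_localTriv_source, ← FiberBundleCore.baseSet_at, hs']
      exact hx
    exact h1.eventually (isOpen_discrete {g | g = (Z.localTriv i (s x)).2} |>.mem_nhds rfl)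
  · simp only [FiberBundleCore.localTriv_apply]
    change (show G from (s x).2) * f (idx (s x).1) i (s x).1 * f i j x =
      (show G from (s x).2) * f (idx (s x).1) j (s x).1
    rw [hs', mul_assoc, hc _ i j x (hidx x) hi hj]

end Topology

namespace NetCoh

open Set in
theorem exists_isLFCover {M : Type u} [TopologicalSpace M] [ParacompactSpace M]
    [PathConnectedSpace M] [T2Space M] [LocallyCompactSpace M] (hM : LocContractible M) :
    ∃ A : Set (OpenContr M), IsLFCover A := by
  have : SigmaCompactSpace M := sigmaCompactSpace_of_connected
  obtain ⟨α, c, r, hr, hu, hlf⟩ :=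
    refinement_of_locallyCompact_sigmaCompact_of_nhds_basis (fun x => hM.nhds_hasBasis (a := x))
  let g : α → OpenContr M := fun i => ⟨⟨r i, (hr i).1.1⟩, (hr i).1.2⟩
  refine ⟨range g, fun x => ?_, ?_⟩
  · obtain ⟨i, hi⟩ := mem_iUnion.1 (hu ▸ mem_univ x)
    exact ⟨g i, mem_range_self i, hi⟩
  · have hinj : Function.Injective
        (fun a : range g => (⟨a.1.1, a.2.imp fun i hi => by rw [← hi]; rfl⟩ : range r)) :=
      fun a b hab => Subtype.ext (Subtype.ext (Opens.ext (congrArg Subtype.val hab)))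
    exact LocallyFinite.comp_injective (g := fun a : range g =>
      (⟨a.1.1, a.2.imp fun i hi => by rw [← hi]; rfl⟩ : range r)) hlf.on_range hinj

/-! ### Cocycles of a poset and homomorphisms of its fundamental group -/

section Poset

variable {K : Type u} [PartialOrder K] {G : Type v} [Group G]

theorem Cocycle.val_ofLE_mul (z : Cocycle K G) {a b c : K} (h : a ≤ b) (h' : b ≤ c) :
    z.val (.ofLE h') * z.val (.ofLE h) = z.val (.ofLE (h.trans h')) :=
  z.cocycle ⟨.ofLE h', .ofLE (h.trans h'), .ofLE h, c, le_rfl, le_rfl, h'⟩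

theorem Cocycle.val_eq (z : Cocycle K G) {a a' : K} (b : OneSimplex a a') :
    z.val b = (z.val (.ofLE b.le₀))⁻¹ * z.val (.ofLE b.le₁) := by
  rw [eq_inv_mul_iff_mul_eq]
  exact z.cocycle ⟨.ofLE b.le₀, .ofLE b.le₁, b, b.supp, le_rfl, le_rfl, le_rfl⟩

/-- The 1-cocycle determined by its values `g h` on the 1-simplices `(a; a, o)` of the nerve,
`h : o ≤ a`: every other value is forced by `Cocycle.val_eq`. -/
def Cocycle.ofNerve (g : ∀ {o a : K}, o ≤ a → G)
    (hg : ∀ {o a b : K} (h : o ≤ a) (h' : a ≤ b), g h' * g h = g (h.trans h')) : Cocycle K G where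
  val b := (g b.le₀)⁻¹ * g b.le₁
  cocycle c := by
    -- Every factor `g` is rewritten as one into the support of the 2-simplex.
    rw [← mul_right_inj (g (c.d₁.le₀.trans c.le₁)), ← hg c.d₁.le₀ c.le₁]
    simp only [mul_assoc, mul_inv_cancel_left]
    rw [hg c.d₁.le₁ c.le₁, ← hg c.d₂.le₁ c.le₂, ← mul_assoc (g c.le₁), hg c.d₁.le₀ c.le₁,
      ← hg c.d₀.le₀ c.le₀]
    simp only [mul_assoc, mul_inv_cancel_left]
    rw [← mul_assoc, hg c.d₀.le₁ c.le₀, ← hg c.d₂.le₀ c.le₂]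
    simp only [mul_assoc, mul_inv_cancel_left]

theorem Cocycle.ofNerve_val_ofLE (g : ∀ {o a : K}, o ≤ a → G)
    (hg : ∀ {o a b : K} (h : o ≤ a) (h' : a ≤ b), g h' * g h = g (h.trans h'))
    {o a : K} (h : o ≤ a) : (Cocycle.ofNerve g hg).val (.ofLE h) = g h := by
  have h1 : g (le_refl a) = 1 := mul_eq_left.1 (hg (le_refl a) (le_refl a))
  change (g (le_refl a))⁻¹ * g h = g h
  rw [h1, inv_one, one_mul]

/-- An equivalence of cocycles need only be checked on the 1-simplices `(a; a, o)` of the nerve. -/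
theorem Cocycle.equiv_of_nerve {z z' : Cocycle K G} (f : K → G)
    (hf : ∀ {o a : K} (h : o ≤ a), f a * z.val (.ofLE h) = z'.val (.ofLE h) * f o) : z ≈ z' := by
  have key : ∀ {a a' : K} (b : OneSimplex a a'), f a' * z.val b = z'.val b * f a := by
    intro a a' b
    rw [z.val_eq, z'.val_eq, mul_assoc, ← hf b.le₁, eq_inv_mul_iff_mul_eq, ← mul_assoc,
      ← hf b.le₀, mul_assoc, mul_inv_cancel_left]
  refine ⟨f, fun {a a'} p => ?_⟩
  induction p with
  | of b => exact key b
  | cons p b ih => simp only [onPath]; rw [← mul_assoc, key, mul_assoc, ih, mul_assoc]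

namespace SPath

theorem homotopic_insert_rev {a b c d e f : K} (p : SPath a b) (q : SPath b c) (r : SPath d c)
    (s : SPath c e) (t : SPath e f) :
    Homotopic (((p.append q).append r.rev).append ((r.append s).append t))
      ((p.append (q.append s)).append t) := by
  have h : ((p.append q).append r.rev).append ((r.append s).append t) =
      ((p.append q).append (r.rev.append r)).append (s.append t) := by simp only [append_assoc]
  have h' : (p.append (q.append s)).append t = (p.append q).append (s.append t) := by
    simp only [append_assoc]
  rw [h, h']
  exact .append_right _ ((Homotopic.append_left _ (rev_append r)).trans (append_degen _))

end SPath

section Comparison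

variable {a₀ : K} (γ : ∀ a, SPath a₀ a) (χ : PosetPi1 a₀ →* G)

/-- The 1-cocycle with values `z b = χ [γ (∂₁ b), b, reverse of γ (∂₀ b)]` defined by a homomorphism
`χ` on the fundamental group and a system `γ` of paths joining the base point to all vertices. -/
def Cocycle.ofHom : Cocycle K G where
  val {a a'} b := χ (PosetPi1.mk (((γ a).append (.of b)).append (γ a').rev))
  cocycle {v₀ v₁ v₂} c := by
    rw [← map_mul]
    refine congrArg χ (Quotient.sound ?_)
    refine (SPath.homotopic_insert_rev (γ v₀) (.of c.d₂) (γ v₁) (.of c.d₀) (γ v₂).rev).trans ?_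
    exact .append_right _ (.append_left _ (SPath.Homotopic.triangle c).symm)

theorem Cocycle.onPath_ofHom {a a' : K} (p : SPath a a') :
    (Cocycle.ofHom γ χ).onPath p =
      χ (PosetPi1.mk (((γ a).append p).append (γ a').rev)) := by
  induction p with
  | of b => rfl
  | cons p b ih =>
    rw [Cocycle.onPath, ih]
    change χ (PosetPi1.mk _) * _ = _
    rw [← map_mul]
    exact congrArg χ (Quotient.sound
      (SPath.homotopic_insert_rev _ p _ (.of b) _))

/-- The holonomy of `Cocycle.ofHom γ χ` is conjugate to `χ`, by the value of `χ` on the loop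
`γ a₀`, which need not be trivial. -/
theorem Cocycle.hom_ofHom : homConj (PosetPi1 a₀) G ((Cocycle.ofHom γ χ).hom a₀) χ := by
  refine ⟨χ (PosetPi1.mk (γ a₀)), ?_⟩
  rintro ⟨p⟩
  rw [eq_mul_inv_iff_mul_eq]
  change _ = _ * (Cocycle.ofHom γ χ).onPath p
  rw [Cocycle.onPath_ofHom, ← map_mul]
  change χ (PosetPi1.mk p) * _ = _
  rw [← map_mul]
  refine congrArg χ (Quotient.sound ?_)
  change SPath.Homotopic ((γ a₀).append p) ((((γ a₀).append p).append (γ a₀).rev).append (γ a₀))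
  rw [SPath.append_assoc _ (γ a₀).rev]
  exact ((SPath.Homotopic.append_left _ (SPath.rev_append _)).trans (SPath.append_degen _)).symm

end Comparison

theorem Cocycle.equiv_iff_hom {a₀ : K} (γ : ∀ a, SPath a₀ a) (z z' : Cocycle K G) :
    z ≈ z' ↔ homConj (PosetPi1 a₀) G (z.hom a₀) (z'.hom a₀) := by
  constructor
  · rintro ⟨f, hf⟩
    refine ⟨f a₀, ?_⟩
    rintro ⟨p⟩
    rw [eq_mul_inv_iff_mul_eq]
    exact (hf p).symm
  · rintro ⟨g, hg⟩
    refine ⟨fun a => z'.onPath (γ a) * g * (z.onPath (γ a))⁻¹, fun {a a'} p => ?_⟩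
    have h := hg (PosetPi1.mk (((γ a).append p).append (γ a').rev))
    change z'.onPath _ = g * z.onPath _ * g⁻¹ at h
    have hrev : ∀ (y : Cocycle K G) (a : K), y.onPath (γ a).rev = (y.onPath (γ a))⁻¹ := by
      intro y a
      rw [eq_inv_iff_mul_eq_one, ← Cocycle.onPath_append,
        y.onPath_homotopic (SPath.append_rev _)]
      exact map_one (y.hom a₀)
    simp only [Cocycle.onPath_append, hrev] at h
    have h' := congrArg (fun t => z'.onPath (γ a') * t * g * (z.onPath (γ a))⁻¹) h
    simpa [mul_assoc] using h'.symm

/-- The bijection between cohomology classes and conjugacy classes of homomorphisms of the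
fundamental group, for a connected poset. -/
noncomputable def H1.equivHomConj {a₀ : K} (hK : ∀ a, Nonempty (SPath a₀ a)) :
    H1 K G ≃ HomConj (PosetPi1 a₀) G :=
  Equiv.ofBijective
    (Quotient.map (fun z => z.hom a₀)
      fun z z' h => (Cocycle.equiv_iff_hom (fun a => (hK a).some) z z').1 h) <| by
    constructor
    · rintro ⟨z⟩ ⟨z'⟩ h
      exact Quotient.sound ((Cocycle.equiv_iff_hom (fun a => (hK a).some) z z').2
        (Quotient.exact h))
    · rintro ⟨χ⟩
      exact ⟨H1.mk (Cocycle.ofHom (fun a => (hK a).some) χ), Quotient.sound (Cocycle.hom_ofHom _ χ)⟩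

end Poset

/-! ### Transport of conjugacy classes along an isomorphism -/

/-- The bijection between conjugacy classes of homomorphisms defined by a group isomorphism. -/
def HomConj.congr {H H' : Type*} [Group H] [Group H'] (φ : H ≃* H') (G : Type v) [Group G] :
    HomConj H G ≃ HomConj H' G :=
  Quotient.congr (φ.monoidHomCongrLeftEquiv) fun χ χ' => by
    constructor
    · rintro ⟨g, hg⟩
      exact ⟨g, fun h => hg (φ.symm h)⟩
    · rintro ⟨g, hg⟩
      exact ⟨g, fun h => by simpa using hg (φ h)⟩

theorem HomConj.congr_mk {H H' : Type*} [Group H] [Group H'] (φ : H ≃* H') (G : Type v) [Group G]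
    (χ : H →* G) :
    HomConj.congr φ G (HomConj.mk χ) = HomConj.mk (χ.comp φ.symm.toMonoidHom) := rfl

end NetCoh

namespace NetCoh

/-! ### From paths of the poset to paths of the space -/

open Path
open unitInterval

variable {M : Type u} [TopologicalSpace M]

instance (o : OpenContr M) : ContractibleSpace o.1 := o.2

theorem OpenContr.nonempty (o : OpenContr M) : ∃ x, x ∈ o.1 :=
  let ⟨x⟩ := (inferInstance : Nonempty o.1); ⟨x.1, x.2⟩

theorem exists_openContr (hM : LocContractible M) {x : M} {U : Set M} (hU : IsOpen U)
    (hx : x ∈ U) : ∃ o : OpenContr M, x ∈ o.1 ∧ (o.1 : Set M) ⊆ U := by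
  obtain ⟨V, ⟨hVo, hVc⟩, hxV, hVU⟩ := hM.exists_subset_of_mem_open hx hU
  exact ⟨⟨⟨V, hVo⟩, hVc⟩, hxV, hVU⟩

theorem exists_le_le (hM : LocContractible M) (o o' : OpenContr M) {x : M} (hx : x ∈ o.1)
    (hx' : x ∈ o'.1) : ∃ w : OpenContr M, x ∈ w.1 ∧ w ≤ o ∧ w ≤ o' := by
  obtain ⟨w, hxw, hw⟩ := exists_openContr hM (o.1 ⊓ o'.1).isOpen ⟨hx, hx'⟩
  exact ⟨w, hxw, fun y hy => (hw hy).1, fun y hy => (hw hy).2⟩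

/-- The homotopy class in `M` of the paths from `x` to `y` inside the open contractible set `o`. -/
noncomputable def OpenContr.pathClass (o : OpenContr M) {x y : M} (hx : x ∈ o.1) (hy : y ∈ o.1) :
    Homotopic.Quotient x y :=
  (Homotopic.Quotient.mk (PathConnectedSpace.somePath (⟨x, hx⟩ : o.1) ⟨y, hy⟩)).map
    ⟨Subtype.val, continuous_subtype_val⟩

namespace OpenContr

variable {o o' : OpenContr M} {x y z : M}

theorem exists_path (hx : x ∈ o.1) (hy : y ∈ o.1) : ∃ γ : Path x y, ∀ t, γ t ∈ o.1 :=
  ⟨(PathConnectedSpace.somePath (⟨x, hx⟩ : o.1) ⟨y, hy⟩).map continuous_subtype_val,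
    fun _ => Subtype.property _⟩

theorem mk_eq_pathClass (hx : x ∈ o.1) (hy : y ∈ o.1) (γ : Path x y) (hγ : ∀ t, γ t ∈ o.1) :
    Homotopic.Quotient.mk γ = o.pathClass hx hy := by
  let γ' : Path (⟨x, hx⟩ : o.1) ⟨y, hy⟩ :=
    { toFun := fun t => ⟨γ t, hγ t⟩
      continuous_toFun := by fun_prop
      source' := Subtype.ext γ.source
      target' := Subtype.ext γ.target }
  have h : Homotopic.Quotient.mk γ' = Homotopic.Quotient.mk (PathConnectedSpace.somePath _ _) :=
    Subsingleton.elim _ _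
  exact congrArg (fun q => Homotopic.Quotient.map q ⟨Subtype.val, continuous_subtype_val⟩) h

theorem pathClass_trans (hx : x ∈ o.1) (hy : y ∈ o.1) (hz : z ∈ o.1) :
    (o.pathClass hx hy).trans (o.pathClass hy hz) = o.pathClass hx hz := by
  obtain ⟨γ, hγ⟩ := exists_path hx hy
  obtain ⟨δ, hδ⟩ := exists_path hy hz
  rw [← mk_eq_pathClass hx hy γ hγ, ← mk_eq_pathClass hy hz δ hδ, ← Homotopic.Quotient.mk_trans]
  refine mk_eq_pathClass _ _ _ fun t => ?_
  rw [Path.trans_apply]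
  split_ifs
  exacts [hγ _, hδ _]

theorem pathClass_self (hx : x ∈ o.1) : o.pathClass hx hx = Homotopic.Quotient.refl x :=
  (mk_eq_pathClass hx hx (Path.refl x) fun _ => hx).symm

theorem pathClass_mono (h : o ≤ o') (hx : x ∈ o.1) (hy : y ∈ o.1) :
    o'.pathClass (h hx) (h hy) = o.pathClass hx hy := by
  obtain ⟨γ, hγ⟩ := exists_path hx hy
  rw [← mk_eq_pathClass hx hy γ hγ, mk_eq_pathClass (h hx) (h hy) γ fun t => h (hγ t)]

theorem pathClass_trans_assoc (hx : x ∈ o.1) (hy : y ∈ o.1) (hz : z ∈ o.1) {w : M}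
    (q : Homotopic.Quotient z w) :
    (o.pathClass hx hy).trans ((o.pathClass hy hz).trans q) = (o.pathClass hx hz).trans q := by
  rw [← Homotopic.Quotient.trans_assoc, pathClass_trans]

/-- A chosen point of an open contractible set. -/
noncomputable def pt (o : OpenContr M) : M := o.nonempty.choose

theorem pt_mem (o : OpenContr M) : o.pt ∈ o.1 := o.nonempty.choose_spec

end OpenContr

open OpenContr

namespace SPath

/-- The homotopy class of paths in `M` between the chosen points of the end vertices that
corresponds to a path of the poset. -/
noncomputable def real : {a a' : OpenContr M} → SPath a a' → Homotopic.Quotient a.pt a'.pt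
  | a, a', of b => OpenContr.pathClass b.supp (b.le₁ (pt_mem a)) (b.le₀ (pt_mem a'))
  | _, _, @cons _ _ _ a' a'' p b =>
    p.real.trans (OpenContr.pathClass b.supp (b.le₁ (pt_mem a')) (b.le₀ (pt_mem a'')))

theorem real_append {a a' a'' : OpenContr M} (p : SPath a a') (q : SPath a' a'') :
    (p.append q).real = p.real.trans q.real := by
  induction q with
  | of b => simp only [append, real]
  | cons q b ih => simp only [append, real, ih, Homotopic.Quotient.trans_assoc]

theorem real_homotopic {a a' : OpenContr M} {p q : SPath a a'} (h : Homotopic p q) :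
    p.real = q.real := by
  induction h with
  | triangle c =>
    simp only [real]
    rw [← pathClass_mono c.le₀, ← pathClass_mono c.le₁, ← pathClass_mono c.le₂, pathClass_trans]
  | append_left p h ih => rw [real_append, real_append, ih]
  | append_right q h ih => rw [real_append, real_append, ih]
  | refl p => rfl
  | symm h ih => exact ih.symm
  | trans h h' ih ih' => exact ih.trans ih'

/-- The homotopy class of the paths in `M` from `x` to `y` that follow the path `p` of the poset. -/
noncomputable def realBetween {a a' : OpenContr M} (p : SPath a a') {x y : M} (hx : x ∈ a.1)
    (hy : y ∈ a'.1) : Homotopic.Quotient x y :=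
  (a.pathClass hx a.pt_mem).trans (p.real.trans (a'.pathClass a'.pt_mem hy))

theorem realBetween_append {a a' a'' : OpenContr M} (p : SPath a a') (q : SPath a' a'')
    {x y z : M} (hx : x ∈ a.1) (hy : y ∈ a'.1) (hz : z ∈ a''.1) :
    (p.append q).realBetween hx hz = (p.realBetween hx hy).trans (q.realBetween hy hz) := by
  simp only [realBetween, real_append, Homotopic.Quotient.trans_assoc]
  rw [pathClass_trans_assoc, pathClass_self, Homotopic.Quotient.refl_trans]

theorem realBetween_of {a a' : OpenContr M} (b : OneSimplex a a') {x y : M} (hx : x ∈ a.1)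
    (hy : y ∈ a'.1) :
    (of b).realBetween hx hy = OpenContr.pathClass b.supp (b.le₁ hx) (b.le₀ hy) := by
  simp only [realBetween, real]
  rw [← pathClass_mono b.le₁, ← pathClass_mono b.le₀, pathClass_trans, pathClass_trans]

end SPath

theorem Follows.source_mem {a a' : OpenContr M} {p : SPath a a'} {x y : M} {γ : Path x y}
    (h : Follows p γ) : x ∈ a.1 := by
  induction h with
  | of b γ hx hx' hγ => exact hx
  | cons p b γ δ hp hx'' hδ ih => exact ih

theorem Follows.target_mem {a a' : OpenContr M} {p : SPath a a'} {x y : M} {γ : Path x y}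
    (h : Follows p γ) : y ∈ a'.1 := by
  cases h with
  | of b γ hx hx' hγ => exact hx'
  | cons p b γ δ hp hx'' hδ => exact hx''

theorem Follows.mk_eq {a a' : OpenContr M} {p : SPath a a'} {x y : M} {γ : Path x y}
    (h : Follows p γ) : Homotopic.Quotient.mk γ = p.realBetween h.source_mem h.target_mem := by
  induction h with
  | of b γ hx hx' hγ => rw [SPath.realBetween_of, mk_eq_pathClass _ _ _ hγ]
  | cons p b γ δ hp hx'' hδ ih =>
    rw [Homotopic.Quotient.mk_trans, ih]
    refine Eq.trans ?_ (SPath.realBetween_append p (.of b) hp.source_mem hp.target_mem hx'').symm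
    rw [SPath.realBetween_of, mk_eq_pathClass _ _ _ hδ]

theorem exists_follows {a a' : OpenContr M} (p : SPath a a') {x y : M} (hx : x ∈ a.1)
    (hy : y ∈ a'.1) : ∃ γ : Path x y, Follows p γ := by
  induction p generalizing y with
  | of b =>
    obtain ⟨γ, hγ⟩ := exists_path (b.le₁ hx) (b.le₀ hy)
    exact ⟨γ, .of b γ hx hy hγ⟩
  | cons p b ih =>
    obtain ⟨γ, hγ⟩ := ih (pt_mem _)
    obtain ⟨δ, hδ⟩ := exists_path (b.le₁ (pt_mem _)) (b.le₀ hy)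
    exact ⟨γ.trans δ, .cons p b γ δ hγ hy hδ⟩

/-- Rewriting the end points along propositional equalities such as `γ 0 = x`. -/
theorem exists_realBetween_cast {a a' : OpenContr M} {x y x' y' : M} {q : Homotopic.Quotient x y}
    (ex : x' = x) (ey : y' = y)
    (h : ∃ (p : SPath a a') (hx : x' ∈ a.1) (hy : y' ∈ a'.1), q.cast ex ey = p.realBetween hx hy) :
    ∃ (p : SPath a a') (hx : x ∈ a.1) (hy : y ∈ a'.1), q = p.realBetween hx hy := by
  subst ex ey
  simpa using h

/-- Every path in `M` is homotopic to a path following a path of the poset, the end vertices being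
arbitrary neighbourhoods of the end points. -/
theorem exists_realBetween_eq (hM : LocContractible M) {a a' : OpenContr M} {x y : M}
    (hx : x ∈ a.1) (hy : y ∈ a'.1) (γ : Path x y) :
    ∃ p : SPath a a', Homotopic.Quotient.mk γ = p.realBetween hx hy := by
  -- A change of neighbourhood of an end point: pass through some `w ⊆ o ∩ o'` around it.
  have bridge : ∀ (o o' : OpenContr M) (y z : M) (hy : y ∈ o.1) (hz : z ∈ o.1) (hz' : z ∈ o'.1),
      ∃ p : SPath o o', o.pathClass hy hz = p.realBetween hy hz' := by
    intro o o' y z hy hz hz'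
    obtain ⟨w, hzw, hwo, hwo'⟩ := exists_le_le hM o o' hz hz'
    refine ⟨(SPath.of ⟨o, le_rfl, hwo⟩).append (.of ⟨o', hwo', le_rfl⟩), ?_⟩
    rw [SPath.realBetween_append _ _ hy hzw hz', SPath.realBetween_of, SPath.realBetween_of,
      pathClass_self, Homotopic.Quotient.trans_refl]
  obtain ⟨t, ht0, htm, ⟨n, htn⟩, ht⟩ := exists_monotone_Icc_subset_open_cover_unitInterval
    (c := fun o : OpenContr M => γ ⁻¹' o.1) (fun o => o.1.isOpen.preimage γ.continuous)
    (fun s _ => by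
      obtain ⟨o, ho, -⟩ := exists_openContr hM isOpen_univ (Set.mem_univ (γ s))
      exact Set.mem_iUnion.2 ⟨o, ho⟩)
  have hx0 : γ 0 ∈ a.1 := by rwa [γ.source]
  have key : ∀ n (o : OpenContr M) (ho : γ (t n) ∈ o.1),
      ∃ p : SPath a o, Homotopic.Quotient.mk (γ.subpath 0 (t n)) = p.realBetween hx0 ho := by
    intro n
    induction n with
    | zero =>
      intro o ho
      revert ho
      rw [ht0]
      intro ho
      obtain ⟨p, hp⟩ := bridge a o _ _ hx0 hx0 ho
      refine ⟨p, ?_⟩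
      rw [← hp, pathClass_self, Path.subpath_self]
      rfl
    | succ n ih =>
      intro o ho
      obtain ⟨c, hc⟩ := ht n
      have hle := htm n.le_succ
      have hcn : γ (t n) ∈ c.1 := hc ⟨le_rfl, hle⟩
      have hcn' : γ (t (n + 1)) ∈ c.1 := hc ⟨hle, le_rfl⟩
      obtain ⟨p, hp⟩ := ih c hcn
      obtain ⟨q, hq⟩ := bridge c o _ _ hcn hcn' ho
      refine ⟨p.append q, ?_⟩
      rw [SPath.realBetween_append p q hx0 hcn ho, ← hp, ← hq,
        ← mk_eq_pathClass hcn hcn' (γ.subpath (t n) (t (n + 1))) fun s => ?_,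
        ← Homotopic.Quotient.mk_trans]
      · exact (Homotopic.Quotient.eq.2
          ⟨Path.Homotopy.subpathTransSubpath γ 0 (t n) (t (n + 1))⟩).symm
      · have hs : γ.subpath (t n) (t (n + 1)) s ∈ Set.range (γ.subpath (t n) (t (n + 1))) :=
          Set.mem_range_self s
        rw [Path.range_subpath_of_le _ _ _ hle] at hs
        obtain ⟨r, hr, hrs⟩ := hs
        rw [← hrs]
        exact hc hr
  have hy1 : γ 1 ∈ a'.1 := by rwa [γ.target]
  obtain ⟨p, hp⟩ : ∃ p : SPath a a',
      Homotopic.Quotient.mk (γ.subpath 0 1) = p.realBetween hx0 hy1 := by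
    have := key n a'
    rw [htn n le_rfl] at this
    exact this hy1
  obtain ⟨p', _, _, hp'⟩ := exists_realBetween_cast (q := Homotopic.Quotient.mk γ) γ.source γ.target
    ⟨p, hx0, hy1, by rw [← hp, Path.subpath_zero_one, Homotopic.Quotient.mk_cast]⟩
  exact ⟨p', hp'⟩

theorem nonempty_sPath [PathConnectedSpace M] (hM : LocContractible M) (a a' : OpenContr M) :
    Nonempty (SPath a a') :=
  let ⟨p, _⟩ := exists_realBetween_eq hM a.pt_mem a'.pt_mem (PathConnectedSpace.somePath _ _)
  ⟨p⟩

/-- The homomorphism from the fundamental group of the poset to that of `M`. -/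
noncomputable def PosetPi1.toFundamentalGroup {a₀ : OpenContr M} {x₀ : M} (hx₀ : x₀ ∈ a₀.1) :
    PosetPi1 a₀ →* FundamentalGroup M x₀ :=
  MonoidHom.mk'
    (Quotient.lift (fun p => FundamentalGroup.fromPath (p.realBetween hx₀ hx₀))
      fun p q h => congrArg (fun r : Homotopic.Quotient a₀.pt a₀.pt =>
        (a₀.pathClass hx₀ a₀.pt_mem).trans
        (r.trans (a₀.pathClass a₀.pt_mem hx₀))) (SPath.real_homotopic h)) <| by
    rintro ⟨p⟩ ⟨q⟩
    exact SPath.realBetween_append q p hx₀ hx₀ hx₀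

theorem PosetPi1.toFundamentalGroup_mk {a₀ : OpenContr M} {x₀ : M} (hx₀ : x₀ ∈ a₀.1)
    {p : SPath a₀ a₀} {γ : Path x₀ x₀} (h : Follows p γ) :
    toFundamentalGroup hx₀ (mk p) = FundamentalGroup.fromPath (Homotopic.Quotient.mk γ) :=
  h.mk_eq.symm

theorem PosetPi1.toFundamentalGroup_surjective (hM : LocContractible M) {a₀ : OpenContr M} {x₀ : M}
    (hx₀ : x₀ ∈ a₀.1) : Function.Surjective (toFundamentalGroup hx₀) := by
  intro q
  obtain ⟨γ, rfl⟩ := Homotopic.Quotient.mk_surjective q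
  obtain ⟨p, hp⟩ := exists_realBetween_eq hM hx₀ hx₀ γ
  exact ⟨mk p, hp.symm⟩

end NetCoh

namespace NetCoh

/-! ### Transition functions, parallel transport and injectivity -/

open Filter Topology unitInterval

variable {M : Type u} [TopologicalSpace M] {G : Type v} [Group G]

theorem locallyPathConnectedSpace (hM : LocContractible M) : LocallyPathConnectedSpace M :=
  .of_bases (fun x => hM.nhds_hasBasis (a := x)) fun _ _ hU =>
    have := hU.1.2
    isPathConnected_iff_pathConnectedSpace.2 inferInstance

open Classical in
/-- The transition function `x ↦ z (a; a, o) z (a'; a', o)⁻¹`, for `x ∈ o ⊆ a ∩ a'`, of a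
1-cocycle; it takes the value `1` where no such `o` exists. -/
noncomputable def Cocycle.trans (z : Cocycle (OpenContr M) G) (a a' : OpenContr M) (x : M) : G :=
  if h : ∃ o : OpenContr M, x ∈ o.1 ∧ o ≤ a ∧ o ≤ a' then
    z.val (.ofLE h.choose_spec.2.1) * (z.val (.ofLE h.choose_spec.2.2))⁻¹
  else 1

namespace Cocycle

theorem mul_inv_eq_of_le {K : Type u} [PartialOrder K] (z : Cocycle K G) {a a' o w : K} (hw : w ≤ o)
    (h : o ≤ a) (h' : o ≤ a') :
    z.val (.ofLE h) * (z.val (.ofLE h'))⁻¹ =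
      z.val (.ofLE (hw.trans h)) * (z.val (.ofLE (hw.trans h')))⁻¹ := by
  rw [← z.val_ofLE_mul hw h, ← z.val_ofLE_mul hw h', mul_inv_rev, mul_assoc, mul_inv_cancel_left]

theorem trans_eq (hM : LocContractible M) (z : Cocycle (OpenContr M) G) {a a' o : OpenContr M}
    {x : M} (hx : x ∈ o.1) (h : o ≤ a) (h' : o ≤ a') :
    z.trans a a' x = z.val (.ofLE h) * (z.val (.ofLE h'))⁻¹ := by
  have hex : ∃ o : OpenContr M, x ∈ o.1 ∧ o ≤ a ∧ o ≤ a' := ⟨o, hx, h, h'⟩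
  rw [trans, dif_pos hex]
  obtain ⟨w, -, hwo, hwo'⟩ := exists_le_le hM o _ hx hex.choose_spec.1
  rw [mul_inv_eq_of_le z hwo h h', mul_inv_eq_of_le z hwo']

theorem trans_of_le (hM : LocContractible M) (z : Cocycle (OpenContr M) G)
    {a o : OpenContr M} {x : M} (hx : x ∈ o.1) (h : o ≤ a) :
    z.trans a o x = z.val (.ofLE h) := by
  rw [trans_eq hM z hx h le_rfl, mul_eq_left, inv_eq_one]
  exact mul_eq_left.1 (z.val_ofLE_mul (le_refl o) (le_refl o))

theorem trans_mul (hM : LocContractible M) (z : Cocycle (OpenContr M) G)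
    {a a' a'' : OpenContr M} {x : M} (h : x ∈ a.1) (h' : x ∈ a'.1)
    (h'' : x ∈ a''.1) : z.trans a a' x * z.trans a' a'' x = z.trans a a'' x := by
  obtain ⟨v, hxv, hva, hva'⟩ := exists_le_le hM a a' h h'
  obtain ⟨w, hxw, hwv, hwa''⟩ := exists_le_le hM v a'' hxv h''
  rw [trans_eq hM z hxw (hwv.trans hva) (hwv.trans hva'),
    trans_eq hM z hxw (hwv.trans hva') hwa'', trans_eq hM z hxw (hwv.trans hva) hwa'',
    mul_assoc, inv_mul_cancel_left]

theorem eventually_trans_eq (hM : LocContractible M) (z : Cocycle (OpenContr M) G)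
    {a a' : OpenContr M} {x : M} (h : x ∈ a.1) (h' : x ∈ a'.1) :
    ∀ᶠ y in 𝓝 x, z.trans a a' y = z.trans a a' x := by
  obtain ⟨w, hxw, hwa, hwa'⟩ := exists_le_le hM a a' h h'
  filter_upwards [w.1.isOpen.mem_nhds hxw] with y hy
  rw [trans_eq hM z hy hwa hwa', trans_eq hM z hxw hwa hwa']

end Cocycle

theorem isLocallyConstant_subtype {X : Type w} [TopologicalSpace X] {Y : Type*} {S : Set X}
    {f : X → Y}
    (hf : ∀ x ∈ S, ∀ᶠ y in 𝓝 x, y ∈ S → f y = f x) :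
    IsLocallyConstant (fun x : S => f x) := by
  rw [IsLocallyConstant.iff_eventually_eq]
  rintro ⟨x, hx⟩
  rw [nhds_subtype_eq_comap]
  exact ((hf x hx).comap _).mono fun s hs => hs s.2

theorem eventually_eq_of_isLocallyConstant {X : Type w} [TopologicalSpace X] {Y : Type*}
    {p : X → Prop} {f : {x // p x} → Y}
    (hf : IsLocallyConstant f) {x : X} (hx : p x) :
    ∀ᶠ y in 𝓝 x, ∀ hy : p y, f ⟨y, hy⟩ = f ⟨x, hx⟩ := by
  have h := (IsLocallyConstant.iff_eventually_eq _).1 hf ⟨x, hx⟩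
  rw [nhds_subtype_eq_comap, eventually_comap] at h
  exact h.mono fun y h hy => h ⟨y, hy⟩ rfl

theorem eq_of_preconnected_of_eventually_eq {X : Type w} [TopologicalSpace X] {S : Set X}
    (hS : IsPreconnected S) {Y : Type*} {f : X → Y}
    (hf : ∀ x ∈ S, ∀ᶠ y in 𝓝 x, y ∈ S → f y = f x) {x y : X} (hx : x ∈ S) (hy : y ∈ S) :
    f x = f y := by
  have : PreconnectedSpace S := isPreconnected_iff_preconnectedSpace.1 hS
  have hl : IsLocallyConstant (fun s : S => f s) :=
    isLocallyConstant_subtype hf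
  exact hl.apply_eq_of_isPreconnected isPreconnected_univ (x := ⟨x, hx⟩) (y := ⟨y, hy⟩)
    trivial trivial

theorem OpenContr.isPreconnected (o : OpenContr M) : IsPreconnected (o.1 : Set M) :=
  isPreconnected_iff_preconnectedSpace.2 (inferInstanceAs (PreconnectedSpace o.1))

/-- Parallel transport. If `h` trivializes over `F : X → M` the transition functions of `z`, then
along any path `τ` in `X` lying over a path that follows `p`, the trivialization changes by `z (p)`:
on each piece it is constant in the chart of the support, and charts of the ends differ from it by
the values of `z` on the nerve. -/
theorem Follows.apply_mul_onPath (hM : LocContractible M) (z : Cocycle (OpenContr M) G)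
    {X : Type w} [TopologicalSpace X] {F : X → M} (h : OpenContr M → X → G)
    (hloc : ∀ (o : OpenContr M) x, F x ∈ o.1 → ∀ᶠ y in 𝓝 x, h o y = h o x)
    (htr : ∀ (o o' : OpenContr M) x, F x ∈ o.1 → F x ∈ o'.1 →
      h o x * z.trans o o' (F x) = h o' x)
    {a a' : OpenContr M} {p : SPath a a'} {x y : M} {γ : Path x y} (hp : Follows p γ)
    (τ : C(I, X)) (hτ : ∀ t, F (τ t) = γ t) : h a' (τ 1) * z.onPath p = h a (τ 0) := by
  have edge : ∀ {a a' : OpenContr M} (b : OneSimplex a a') {x y : M} (γ : Path x y),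
      x ∈ a.1 → y ∈ a'.1 → (∀ t, γ t ∈ b.supp.1) → ∀ (τ : C(I, X)), (∀ t, F (τ t) = γ t) →
      h a' (τ 1) * z.val b = h a (τ 0) := by
    intro a a' b x y γ hx hy hγ τ hτ
    have hs : ∀ t, F (τ t) ∈ b.supp.1 := fun t => hτ t ▸ hγ t
    have hconst : h b.supp (τ 0) = h b.supp (τ 1) :=
      eq_of_preconnected_of_eventually_eq (f := fun t => h b.supp (τ t)) isPreconnected_univ
        (fun t _ => ((τ.continuous.tendsto t).eventually (hloc _ _ (hs t))).mono fun _ h _ => h)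
        trivial trivial
    have h0 : F (τ 0) ∈ a.1 := by rw [hτ, γ.source]; exact hx
    have h1 : F (τ 1) ∈ a'.1 := by rw [hτ, γ.target]; exact hy
    rw [← htr b.supp a _ (hs 0) h0, ← htr b.supp a' _ (hs 1) h1, Cocycle.trans_of_le hM z h0 b.le₁,
      Cocycle.trans_of_le hM z h1 b.le₀, z.val_eq b, hconst, mul_assoc, mul_inv_cancel_left]
  induction hp generalizing τ with
  | of b γ hx hx' hγ => exact edge b γ hx hx' hγ τ hτ
  | cons p b γ δ hp hx'' hδ ih =>
    -- The two halves of `τ`, reparametrized by the unit interval.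
    let l : C(I, I) := ⟨fun t => ⟨t / 2, by
      constructor <;> linarith [t.2.1, t.2.2]⟩, by fun_prop⟩
    let r : C(I, I) := ⟨fun t => ⟨(1 + t) / 2, by
      constructor <;> linarith [t.2.1, t.2.2]⟩, by fun_prop⟩
    have hl0 : l 0 = 0 := Subtype.ext (by simp [l])
    have hr1 : r 1 = 1 := Subtype.ext (by norm_num [r])
    have hlr : l 1 = r 0 := Subtype.ext (by simp [l, r])
    have e1 := ih (τ.comp l) fun t => by
      rw [ContinuousMap.comp_apply, hτ, Path.trans_apply, dif_pos]
      · exact congrArg γ (Subtype.ext (by simp [l]; ring))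
      · change (t : ℝ) / 2 ≤ 1 / 2
        linarith [t.2.2]
    have e2 := edge b δ hp.target_mem hx'' hδ (τ.comp r) fun t => by
      rw [ContinuousMap.comp_apply, hτ, Path.trans_apply]
      split_ifs with ht
        -- `Path.trans` uses its first half at the common end point.
      · have ht0 : t = 0 := Subtype.ext (by
          change (1 + (t : ℝ)) / 2 ≤ 1 / 2 at ht
          have := t.2.1
          change (t : ℝ) = 0
          linarith)
        subst ht0
        rw [δ.source]
        refine Eq.trans (congrArg γ (Subtype.ext ?_)) γ.target
        simp [r]
      · exact congrArg δ (Subtype.ext (by simp [r]; ring))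
    simp only [ContinuousMap.comp_apply, hl0, hr1, hlr] at e1 e2
    rw [Cocycle.onPath, ← mul_assoc, e2, e1]

/-- The holonomy of a cocycle is trivial along a loop of the poset followed by a null-homotopic
loop. -/
theorem onPath_eq_one_of_homotopic_refl (hM : LocContractible M) (z : Cocycle (OpenContr M) G)
    {a₀ : OpenContr M} {p : SPath a₀ a₀} {x₀ : M} {γ : Path x₀ x₀} (hp : Follows p γ)
    (hγ : γ.Homotopic (Path.refl x₀)) : z.onPath p = 1 := by
  obtain ⟨H⟩ := hγ
  -- The homotopy is extended to the plane, which is contractible and locally path connected.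
  let proj : ℝ → I := Set.projIcc 0 1 zero_le_one
  have hproj : Continuous proj := continuous_projIcc
  let F : ℝ × ℝ → M := fun s => H (proj s.1, proj s.2)
  have hF : Continuous F := by fun_prop
  obtain ⟨h, hloc, htr⟩ := exists_trivialization (fun o : OpenContr M => F ⁻¹' o.1)
    (fun o => o.1.isOpen.preimage hF)
    (fun s => (exists_openContr hM isOpen_univ (Set.mem_univ (F s))).imp fun o ho => ho.1)
    (fun o o' s => z.trans o o' (F s))
    (fun o o' s ho ho' =>
      (hF.tendsto s).eventually (Cocycle.eventually_trans_eq hM z ho ho'))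
    (fun o o' o'' s ho ho' ho'' => Cocycle.trans_mul hM z ho ho' ho'')
  have hpI : ∀ t : I, proj t = t := fun t => Set.projIcc_val _ t
  -- `e1` is transport along the edge `γ` of the square; on the other three edges the homotopy is
  -- constant, hence so is the trivialization.
  have e1 := hp.apply_mul_onPath hM z h hloc htr ⟨fun t : I => ((0 : ℝ), (t : ℝ)), by fun_prop⟩
    fun t => by
      change H (proj ((0 : I) : ℝ), proj t) = γ t
      rw [hpI, hpI]
      exact H.apply_zero t
  have hx₀ := hp.source_mem
  have const : ∀ τ : C(I, ℝ × ℝ), (∀ t, F (τ t) = x₀) → h a₀ (τ 0) = h a₀ (τ 1) := fun τ hτ =>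
    eq_of_preconnected_of_eventually_eq (f := fun t => h a₀ (τ t)) isPreconnected_univ
      (fun t _ => ((τ.continuous.tendsto t).eventually (hloc a₀ _ (by
        change F (τ t) ∈ a₀.1; rw [hτ]; exact hx₀))).mono fun _ h _ => h)
      trivial trivial
  have e2 := const ⟨fun t : I => ((t : ℝ), (0 : ℝ)), by fun_prop⟩ fun t => by
    change H (proj t, proj ((0 : I) : ℝ)) = x₀
    rw [hpI, hpI]
    exact H.source t
  have e3 := const ⟨fun t : I => ((1 : ℝ), (t : ℝ)), by fun_prop⟩ fun t => by
    change H (proj ((1 : I) : ℝ), proj t) = x₀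
    rw [hpI, hpI]
    exact H.apply_one t
  have e4 := const ⟨fun t : I => ((t : ℝ), (1 : ℝ)), by fun_prop⟩ fun t => by
    change H (proj t, proj ((1 : I) : ℝ)) = x₀
    rw [hpI, hpI]
    exact H.target t
  simp only [ContinuousMap.coe_mk, Set.Icc.coe_zero, Set.Icc.coe_one] at e1 e2 e3 e4
  rwa [e4, ← e3, ← e2, mul_eq_left] at e1

theorem PosetPi1.toFundamentalGroup_injective [PathConnectedSpace M] (hM : LocContractible M)
    {a₀ : OpenContr M} {x₀ : M} (hx₀ : x₀ ∈ a₀.1) :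
    Function.Injective (toFundamentalGroup hx₀) := by
  rw [injective_iff_map_eq_one]
  rintro ⟨p⟩ hp
  obtain ⟨γ, hγ⟩ := exists_follows p hx₀ hx₀
  have hhom : γ.Homotopic (Path.refl x₀) :=
    Path.Homotopic.Quotient.eq.1 ((toFundamentalGroup_mk hx₀ hγ).symm.trans hp)
  -- The cocycle whose holonomy is, up to conjugation, the identity of the poset group.
  let z := Cocycle.ofHom (fun a => (nonempty_sPath hM a₀ a).some) (MonoidHom.id (PosetPi1 a₀))
  obtain ⟨g, hg⟩ := Cocycle.hom_ofHom (fun a => (nonempty_sPath hM a₀ a).some)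
    (MonoidHom.id (PosetPi1 a₀))
  have h1 : z.hom a₀ (mk p) = 1 := onPath_eq_one_of_homotopic_refl hM z hγ hhom
  have h2 := hg (mk p)
  rw [h1, mul_one, mul_inv_cancel] at h2
  exact h2

/-- The isomorphism between the fundamental group of the poset of open contractible subsets and
that of the space. -/
noncomputable def PosetPi1.equivFundamentalGroup [PathConnectedSpace M] (hM : LocContractible M)
    {a₀ : OpenContr M} {x₀ : M} (hx₀ : x₀ ∈ a₀.1) : PosetPi1 a₀ ≃* FundamentalGroup M x₀ :=
  MulEquiv.ofBijective (toFundamentalGroup hx₀)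
    ⟨toFundamentalGroup_injective hM hx₀, toFundamentalGroup_surjective hM hx₀⟩

end NetCoh

namespace NetCoh

/-! ### Comparison with locally constant cohomology -/

open Filter Topology

variable {M : Type u} [TopologicalSpace M] {G : Type v} [Group G]

/-- The locally constant cocycle induced by a 1-cocycle `z` on a locally finite cover `A`. -/
noncomputable def LCCocycle.ofCocycle (hM : LocContractible M) {A : Set (OpenContr M)}
    (hA : IsLFCover A) (z : Cocycle (OpenContr M) G) : LCCocycle M G where
  A := A
  isLFCover := hA
  f a a' x := z.trans a.1 a'.1 x.1
  locConst a a' := isLocallyConstant_subtype (S := {x | x ∈ a.1.1 ∧ x ∈ a'.1.1}) fun _ hx =>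
    (z.eventually_trans_eq hM hx.1 hx.2).mono fun _ h _ => h
  cocycle _ _ _ _ h h' h'' := z.trans_mul hM h'' h' h

theorem LCCocycle.isInducedBy_ofCocycle (hM : LocContractible M) {A : Set (OpenContr M)}
    (hA : IsLFCover A) (z : Cocycle (OpenContr M) G) : IsInducedBy (ofCocycle hM hA z) z :=
  fun _ _ _ h h' _ hx => z.trans_eq hM hx h h'

theorem LCCocycle.ofCocycle_equiv_of_equiv (hM : LocContractible M) {A B : Set (OpenContr M)}
    (hA : IsLFCover A) (hB : IsLFCover B) {z z' : Cocycle (OpenContr M) G} (h : z ≈ z') :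
    Equiv (ofCocycle hM hA z) (ofCocycle hM hB z') := by
  obtain ⟨g, hg⟩ := h
  have hg' : ∀ {o a : OpenContr M} (h : o ≤ a), g a * z.val (.ofLE h) = z'.val (.ofLE h) * g o :=
    fun h => hg (.of (.ofLE h))
  have htr : ∀ {a a' : OpenContr M} {x : M}, x ∈ a.1 → x ∈ a'.1 →
      z.trans a a' x * (g a')⁻¹ = (g a)⁻¹ * z'.trans a a' x := by
    intro a a' x h h'
    obtain ⟨w, hxw, hwa, hwa'⟩ := exists_le_le hM a a' h h'
    rw [z.trans_eq hM hxw hwa hwa', z'.trans_eq hM hxw hwa hwa', mul_assoc, ← mul_inv_rev, hg',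
      mul_inv_rev, eq_inv_mul_iff_mul_eq, ← mul_assoc, hg', ← mul_assoc, mul_inv_cancel_right]
  refine ⟨fun a b x => z.trans a.1 b.1 x.1 * (g b.1)⁻¹, fun a b => ?_, ?_⟩
  · exact isLocallyConstant_subtype (S := {x | x ∈ a.1.1 ∧ x ∈ b.1.1})
      (f := fun x => z.trans a.1 b.1 x * (g b.1)⁻¹) fun x hx =>
        (z.eventually_trans_eq hM hx.1 hx.2).mono fun y h _ => by rw [h]
  · intro a a' b b' x ha ha' hb hb'
    change z.trans a.1 b.1 x * (g b.1)⁻¹ * z'.trans b.1 b'.1 x =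
      z.trans a.1 a'.1 x * (z.trans a'.1 b'.1 x * (g b'.1)⁻¹)
    rw [mul_assoc, ← htr hb hb', ← mul_assoc, ← mul_assoc, z.trans_mul hM ha hb hb',
      z.trans_mul hM ha ha' hb']

/-- Inducing locally constant cocycles is injective on classes. -/
theorem LCCocycle.equiv_of_ofCocycle_equiv (hM : LocContractible M) {A B : Set (OpenContr M)}
    (hA : IsLFCover A) (hB : IsLFCover B) {z z' : Cocycle (OpenContr M) G}
    (h : Equiv (ofCocycle hM hA z) (ofCocycle hM hB z')) : z ≈ z' := by
  obtain ⟨v, hv, h⟩ : ∃ v : (a : A) → (b : B) → {x : M // x ∈ a.1.1 ∧ x ∈ b.1.1} → G,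
      (∀ a b, IsLocallyConstant (v a b)) ∧
      ∀ (a a' : A) (b b' : B) (x : M) (ha : x ∈ a.1.1) (ha' : x ∈ a'.1.1) (hb : x ∈ b.1.1)
        (hb' : x ∈ b'.1.1), v a b ⟨x, ha, hb⟩ * z'.trans b b' x =
          z.trans a a' x * v a' b' ⟨x, ha', hb'⟩ := h
  choose s hsA hs using hA.cover
  choose t htB ht using hB.cover
  -- The equivalence `v`, transported by the transition functions from the covers to every `o`; its
  -- value does not depend on the members of the covers used.
  let g (o : OpenContr M) (x : M) : G :=
    z.trans o (s x) x * v ⟨s x, hsA x⟩ ⟨t x, htB x⟩ ⟨x, hs x, ht x⟩ * z'.trans (t x) o x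
  have hg : ∀ (o : OpenContr M) (x : M) (_ : x ∈ o.1) (a : A) (b : B) (ha : x ∈ a.1.1)
      (hb : x ∈ b.1.1),
      g o x = z.trans o a x * v a b ⟨x, ha, hb⟩ * z'.trans b o x := by
    intro o x hx a b ha hb
    have := h ⟨s x, hsA x⟩ a ⟨t x, htB x⟩ b x (hs x) ha (ht x) hb
    rw [← z.trans_mul hM hx (hs x) ha, mul_assoc (z.trans o (s x) x), ← this]
    simp only [g, mul_assoc]
    rw [z'.trans_mul hM (ht x) hb hx]
  have hloc : ∀ (o : OpenContr M) (x : M), x ∈ o.1 → ∀ᶠ y in 𝓝 x, y ∈ (o.1 : Set M) →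
      g o y = g o x := by
    intro o x hx
    filter_upwards [z.eventually_trans_eq hM hx (hs x), z'.eventually_trans_eq hM (ht x) hx,
      eventually_eq_of_isLocallyConstant (hv ⟨s x, hsA x⟩ ⟨t x, htB x⟩) ⟨hs x, ht x⟩,
      (s x).1.isOpen.mem_nhds (hs x), (t x).1.isOpen.mem_nhds (ht x)] with y h1 h2 h3 hsy hty hy
    rw [hg o y hy ⟨s x, hsA x⟩ ⟨t x, htB x⟩ hsy hty, h1, h2, h3 ⟨hsy, hty⟩]
  refine Setoid.symm (Cocycle.equiv_of_nerve (fun o => g o o.pt) fun {o a} ho => ?_)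
  have hx := o.pt_mem
  rw [eq_of_preconnected_of_eventually_eq a.isPreconnected (hloc a) a.pt_mem (ho hx),
    hg a o.pt (ho hx) ⟨_, hsA o.pt⟩ ⟨_, htB o.pt⟩ (hs _) (ht _),
    hg o o.pt hx ⟨_, hsA o.pt⟩ ⟨_, htB o.pt⟩ (hs _) (ht _),
    ← z'.trans_of_le hM hx ho, ← z.trans_of_le hM hx ho, mul_assoc,
    z'.trans_mul hM (ht _) (ho hx) hx,
    ← mul_assoc, ← mul_assoc, z.trans_mul hM (ho hx) hx (hs _)]

/-- A locally constant cocycle is trivial over every open contractible set `o`. The functions `h a`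
are total; only their values on `o ∩ a` matter. -/
theorem LCCocycle.exists_trivialization_on (hM : LocContractible M) (c : LCCocycle M G)
    (o : OpenContr M) : ∃ h : c.A → M → G,
      (∀ (a : c.A) (x : M), x ∈ o.1 → x ∈ a.1.1 → ∀ᶠ y in 𝓝 x, h a y = h a x) ∧
      ∀ (a a' : c.A) (x : M), x ∈ o.1 → ∀ (ha : x ∈ a.1.1) (ha' : x ∈ a'.1.1),
        h a x * c.f a a' ⟨x, ha, ha'⟩ = h a' x := by
  classical
  have := locallyPathConnectedSpace hM
  have : LocallyPathConnectedSpace o.1 := o.1.isOpen.locallyPathConnectedSpace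
  let F (a a' : c.A) (x : M) : G :=
    if h : x ∈ a.1.1 ∧ x ∈ a'.1.1 then c.f a a' ⟨x, h⟩ else 1
  have hF : ∀ (a a' : c.A) (x : M) (h : x ∈ a.1.1) (h' : x ∈ a'.1.1),
      F a a' x = c.f a a' ⟨x, h, h'⟩ := fun a a' x h h' => dif_pos ⟨h, h'⟩
  obtain ⟨h, hloc, htr⟩ := exists_trivialization (X := o.1)
    (fun a : c.A => Subtype.val ⁻¹' (a.1.1 : Set M))
    (fun a => a.1.1.isOpen.preimage continuous_subtype_val)
    (fun x => let ⟨a, ha, hx⟩ := c.isLFCover.cover x.1; ⟨⟨a, ha⟩, hx⟩)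
    (fun a a' x => F a a' x.1)
    (fun a a' x ha ha' => by
      refine (continuous_subtype_val.tendsto x).eventually (p := fun y => F a a' y = F a a' x) ?_
      filter_upwards [eventually_eq_of_isLocallyConstant (c.locConst a a') ⟨ha, ha'⟩,
        a.1.1.isOpen.mem_nhds ha, a'.1.1.isOpen.mem_nhds ha'] with y hy hya hya'
      rw [hF a a' y hya hya', hF a a' x ha ha', hy])
    (fun a a' a'' x ha ha' ha'' => by
      rw [hF a a' _ ha ha', hF a' a'' _ ha' ha'', hF a a'' _ ha ha'']
      exact c.cocycle a'' a' a x ha'' ha' ha)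
  have hval : ∀ (a : c.A) (x : M) (hx : x ∈ o.1),
      (if hx : x ∈ o.1 then h a ⟨x, hx⟩ else 1) = h a ⟨x, hx⟩ := fun a x hx => dif_pos hx
  refine ⟨fun a x => if hx : x ∈ o.1 then h a ⟨x, hx⟩ else 1, fun a x hx ha => ?_,
    fun a a' x hx ha ha' => ?_⟩
  · have h1 := hloc a ⟨x, hx⟩ ha
    rw [nhds_subtype_eq_comap, eventually_comap] at h1
    filter_upwards [h1, o.1.isOpen.mem_nhds hx] with y hy hyo
    rw [hval a y hyo, hval a x hx, hy ⟨y, hyo⟩ rfl]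
  · dsimp only
    rw [hval a x hx, hval a' x hx, ← htr a a' ⟨x, hx⟩ ha ha', hF a a' x ha ha']

/-- Every locally constant cocycle is equivalent to one induced, on any given cover, by a cocycle of
the poset. -/
theorem LCCocycle.exists_equiv_ofCocycle (hM : LocContractible M) (c : LCCocycle M G)
    {A : Set (OpenContr M)} (hA : IsLFCover A) :
    ∃ z : Cocycle (OpenContr M) G, Equiv c (ofCocycle hM hA z) := by
  choose h hloc htr using c.exists_trivialization_on hM
  choose s hsA hs using c.isLFCover.cover
  -- The comparison of the trivializations over `o ≤ o'`: independent of the member of the cover,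
  -- hence locally constant, hence constant on `o`.
  let k (o' o : OpenContr M) (x : M) : G := h o' ⟨s x, hsA x⟩ x * (h o ⟨s x, hsA x⟩ x)⁻¹
  have hk : ∀ (o' o : OpenContr M) (x : M), x ∈ o'.1 → x ∈ o.1 → ∀ a : c.A, x ∈ a.1.1 →
      k o' o x = h o' a x * (h o a x)⁻¹ := by
    intro o' o x hx' hx a ha
    rw [← htr o' ⟨s x, hsA x⟩ a x hx' (hs x) ha, ← htr o ⟨s x, hsA x⟩ a x hx (hs x) ha,
      mul_inv_rev, mul_assoc, mul_inv_cancel_left]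
  have hkloc : ∀ (o' o : OpenContr M), o ≤ o' → ∀ x ∈ (o.1 : Set M), ∀ᶠ y in 𝓝 x,
      y ∈ (o.1 : Set M) → k o' o y = k o' o x := by
    intro o' o ho x hx
    filter_upwards [hloc o' ⟨s x, hsA x⟩ x (ho hx) (hs x), hloc o ⟨s x, hsA x⟩ x hx (hs x),
      (s x).1.isOpen.mem_nhds (hs x)] with y h1 h2 hsy hy
    rw [hk o' o y (ho hy) hy ⟨s x, hsA x⟩ hsy, h1, h2]
  have hkconst : ∀ {o' o : OpenContr M}, o ≤ o' → ∀ {x}, x ∈ o.1 → k o' o o.pt = k o' o x :=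
    fun ho x hx => eq_of_preconnected_of_eventually_eq (OpenContr.isPreconnected _)
      (hkloc _ _ ho) (OpenContr.pt_mem _) hx
  have hkmul : ∀ {o a b : OpenContr M} (_ : o ≤ a) (_ : a ≤ b),
      k b a a.pt * k a o o.pt = k b o o.pt := by
    intro o a b hoa hab
    rw [hkconst hab (hoa o.pt_mem), mul_assoc, inv_mul_cancel_left]
  let z : Cocycle (OpenContr M) G := Cocycle.ofNerve (fun {o a} _ => k a o o.pt) hkmul
  have hz : ∀ {a o : OpenContr M} (ho : o ≤ a), z.val (.ofLE ho) = k a o o.pt :=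
    fun ho => Cocycle.ofNerve_val_ofLE _ hkmul ho
  refine ⟨z, fun a b x => (h b.1 a x)⁻¹, fun a b => ?_, ?_⟩
  · exact isLocallyConstant_subtype (S := {x | x ∈ a.1.1 ∧ x ∈ b.1.1})
      (f := fun x => (h b.1 a x)⁻¹) fun x hx =>
        (hloc b.1 a x hx.2 hx.1).mono fun y h _ => by rw [h]
  · intro a a' b b' x ha ha' hb hb'
    change (h b.1 a x)⁻¹ * z.trans b.1 b'.1 x = c.f a a' ⟨x, ha, ha'⟩ * (h b'.1 a' x)⁻¹
    obtain ⟨w, hxw, hwb, hwb'⟩ := exists_le_le hM b.1 b'.1 hb hb'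
    rw [z.trans_eq hM hxw hwb hwb', hz, hz, hkconst hwb hxw, hkconst hwb' hxw,
      hk _ _ x hb hxw a ha, hk _ _ x hb' hxw a ha, ← htr b'.1 a a' x hb' ha ha']
    simp [mul_assoc]

/-- The bijection between the cohomology of the poset of open contractible subsets and the locally
constant cohomology of the space. -/
noncomputable def H1.equivH1lc (hM : LocContractible M) (G : Type v) [Group G]
    {A : Set (OpenContr M)} (hA : IsLFCover A) : H1 (OpenContr M) G ≃ H1lc M G :=
  Equiv.ofBijective
    (Quotient.map (LCCocycle.ofCocycle hM hA)
      fun _ _ h => LCCocycle.ofCocycle_equiv_of_equiv hM hA hA h) <| by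
    constructor
    · rintro ⟨z⟩ ⟨z'⟩ h
      exact Quotient.sound (LCCocycle.equiv_of_ofCocycle_equiv hM hA hA (Quotient.exact h))
    · rintro ⟨c⟩
      obtain ⟨z, hz⟩ := c.exists_equiv_ofCocycle hM hA
      exact ⟨H1.mk z, Quotient.sound (LCCocycle.equiv_symm hz)⟩

theorem H1.equivH1lc_mk (hM : LocContractible M) {A B : Set (OpenContr M)} (hA : IsLFCover A)
    (hB : IsLFCover B) (z : Cocycle (OpenContr M) G) :
    H1.equivH1lc hM G hA (H1.mk z) = H1lc.mk (LCCocycle.ofCocycle hM hB z) :=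
  Quotient.sound (LCCocycle.ofCocycle_equiv_of_equiv hM hA hB (Setoid.refl z))

end NetCoh

theorem theorem6p3 {M : Type u} [TopologicalSpace M] [ParacompactSpace M] [PathConnectedSpace M]
    (hM : NetCoh.LocContractible M) (G : Type v) [Group G]
    (a₀ : NetCoh.OpenContr M) (x₀ : M) (hx₀ : x₀ ∈ a₀.1) :
    ∃ (e₁ : NetCoh.H1 (NetCoh.OpenContr M) G ≃ NetCoh.HomConj (NetCoh.PosetPi1 a₀) G)
      (φ : NetCoh.PosetPi1 a₀ ≃* FundamentalGroup M x₀)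
      (e₂ : NetCoh.HomConj (NetCoh.PosetPi1 a₀) G ≃ NetCoh.HomConj (FundamentalGroup M x₀) G),
      (∀ z : NetCoh.Cocycle (NetCoh.OpenContr M) G,
        e₁ (NetCoh.H1.mk z) = NetCoh.HomConj.mk (z.hom a₀)) ∧
      (∀ (p : NetCoh.SPath a₀ a₀) (γ : Path x₀ x₀), NetCoh.Follows p γ →
        φ (NetCoh.PosetPi1.mk p) =
          FundamentalGroup.fromPath (Path.Homotopic.Quotient.mk γ)) ∧
      (∀ χ : NetCoh.PosetPi1 a₀ →* G,
        e₂ (NetCoh.HomConj.mk χ) = NetCoh.HomConj.mk (χ.comp φ.symm.toMonoidHom)) ∧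
      ((∃ A : Set (NetCoh.OpenContr M), NetCoh.IsLFCover A) →
        ∃ e₃ : NetCoh.HomConj (FundamentalGroup M x₀) G ≃ NetCoh.H1lc M G,
          ∀ (z : NetCoh.Cocycle (NetCoh.OpenContr M) G) (A : Set (NetCoh.OpenContr M)),
            NetCoh.IsLFCover A →
            ∃ c : NetCoh.LCCocycle M G, c.A = A ∧ NetCoh.IsInducedBy c z ∧
              e₃ (e₂ (e₁ (NetCoh.H1.mk z))) = NetCoh.H1lc.mk c) ∧
      (T2Space M → LocallyCompactSpace M →
        ∃ A : Set (NetCoh.OpenContr M), NetCoh.IsLFCover A) := by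
  let e₁ := NetCoh.H1.equivHomConj (G := G) (NetCoh.nonempty_sPath hM a₀)
  let φ := NetCoh.PosetPi1.equivFundamentalGroup hM hx₀
  let e₂ := NetCoh.HomConj.congr φ G
  refine ⟨e₁, φ, e₂, fun z => rfl, fun p γ h => NetCoh.PosetPi1.toFundamentalGroup_mk hx₀ h,
    NetCoh.HomConj.congr_mk φ G, ?_, fun _ _ => NetCoh.exists_isLFCover hM⟩
  rintro ⟨A, hA⟩
  refine ⟨(e₂.symm.trans e₁.symm).trans (NetCoh.H1.equivH1lc hM G hA), fun z B hB =>
    ⟨NetCoh.LCCocycle.ofCocycle hM hB z, rfl, NetCoh.LCCocycle.isInducedBy_ofCocycle hM hB z, ?_⟩⟩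
  simpa using NetCoh.H1.equivH1lc_mk hM hA hB z
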